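/- Consider a slotted-time multi-hop wireless network: a directed graph and a finite set $\mathcal S$ of flows, each with a fixed loop-free route; flow $s$ has $H(s)\ge 1$ hops, and $\mathcal P=\{(s,k): s\in\mathcal S,\ 1\le k\le H(s)\}$ is the set of link-flow-pairs, with an arbitrary interference relation. A feasible schedule is a vector $M\in\{0,1\}^{\mathcal P}$ such that no two distinct pairs with $M=1$ interfere; $\mathcal M$ is the set of feasible schedules and $Co(\mathcal M)$ its convex hull. If $A_s(t)$ packets of flow $s$ arrive in slot $t$ and the schedule $M(t)\in\mathcal M$ is used, the queue lengths satisfy $$Q_{s,k}(t+1)=Q_{s,k}(t)+\Psi_{s,k-1}(t)-\Psi_{s,k}(t),\qquad \Psi_{s,k}(t)=\min(M_{s,k}(t),Q_{s,k}(t))\ (k\ge 1),\quad \Psi_{s,0}(t)=A_s(t).$$ Queue-length-based Back-Pressure (Q-BP) chooses in every slot, with arbitrary tie-breaking, $$M(t)\in\arg\max_{M\in\mathcal M}\sum_{(s,k)\in\mathcal P}\bigl(Q_{s,k}(t)-Q_{s,k+1}(t)\bigr)M_{s,k},\qquad Q_{s,H(s)+1}:=0 .$$ Let $\lambda=(\lambda_s)$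 be strictly inside the optimal throughput region $\Lambda^*$: there is $\phi\in Co(\mathcal M)$ with $\lambda_s<\phi_{s,k}$ for all $(s,k)\in\mathcal P$. Then there is $T>0$, depending only on the network and on $\lambda$, such that the following holds for all arrival processes with $\frac1t\sum_{\tau<t}A_s(\tau)\to\lambda_s$ almost surely for every $s$. (a) Fluid model. Almost surely, every fluid limit $q$ of the queue lengths under Q-BP (a limit, uniform on compact subsets of $[0,\infty)$, of $Q^{(n)}(\lfloor x_nt\rfloor)/x_n$, where $x_n\to\infty$ and $Q^{(n)}$ are queue-length paths under Q-BP driven by the given arrivals with $\|Q^{(n)}(0)\|_1=x_n$) is differentiable at almost every $t>0$; the Lyapunov function $V(q)=\frac12\sum_{(s,k)}q_{s,k}^2$ satisfies $\frac{d^+}{dt}V(q(t))<0$ at every $t\ge 0$ at which $q$ is right-differentiable and $V(q(t))>0$; and $q(t)=0$ for all $t\ge T$. (b) Network. Suppose moreover that, for some filtration $(\mathcal F_t)$ for which $M(t)$ is $\mathcal F_t$-measurable and $A(t)$ is $\mathcal F_{t+1}$-measurable, $\sup_{t,s}E[A_s(t)^2]<\infty$, and for every $\delta>0$ there is $n\ge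 1$ with $E\bigl[\sum_{\tau=t}^{t+n-1}A_s(\tau)\,\big|\,\mathcal F_t\bigr]\le n(\lambda_s+\delta)$ almost surely for all $t$ and $s$ (for example, $A(t)$ is independent of $\mathcal F_t$, with the same square-integrable law in every slot). Then from every deterministic initial queue-length vector the network is stable under Q-BP: $$\limsup_{t\to\infty}\frac1t\sum_{\tau=0}^{t-1}E\bigl[\|Q(\tau)\|_1\bigr]<\infty .$$ -/

import Mathlib

open Filter Topology MeasureTheory ProbabilityTheory

universe u v w

/-- A multi-hop wireless network: a directed graph on the nodes `V`, and flows `S`, each with one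
fixed loop-free route of `hops s ≥ 1` links. The link-flow-pairs are `(s, k)` with `k < hops s`
(hops are counted from `0`), and `interferes` is an arbitrary interference relation on them. -/
structure WirelessNetwork (V S : Type*) where
  graph : Digraph V
  hops : S → ℕ
  hops_pos : ∀ s, 0 < hops s
  route : (s : S) → Fin (hops s + 1) → V
  route_adj : ∀ (s : S) (k : Fin (hops s)), graph.Adj (route s k.castSucc) (route s k.succ)
  route_loopfree : ∀ s, Function.Injective (route s)
  interferes : (Σ s : S, Fin (hops s)) → (Σ s : S, Fin (hops s)) → Prop

namespace WirelessNetwork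

variable {V S : Type*}

/-- The set of link-flow-pairs. -/
abbrev Pair (N : WirelessNetwork V S) : Type _ := Σ s : S, Fin (N.hops s)

/-- The feasible schedules: `0`-`1` vectors in which no two distinct active link-flow-pairs
interfere. -/
def feasible (N : WirelessNetwork V S) : Set (N.Pair → ℕ) :=
  {M | (∀ p, M p = 0 ∨ M p = 1) ∧ ∀ p r, p ≠ r → M p = 1 → M r = 1 → ¬ N.interferes p r}

/-- The convex hull of the feasible schedules. -/
def scheduleHull (N : WirelessNetwork V S) : Set (N.Pair → ℝ) :=
  convexHull ℝ ((fun (M : N.Pair → ℕ) (p : N.Pair) => (M p : ℝ)) '' N.feasible)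

/-- The vector of arrival rates lies strictly inside the optimal throughput region. -/
def StrictlyInside (N : WirelessNetwork V S) (rate : S → ℝ) : Prop :=
  ∃ φ ∈ N.scheduleHull, ∀ p : N.Pair, rate p.1 < φ p

/-- The queue length at the next hop of the route, which is `0` after the last hop. -/
def nextQueue (N : WirelessNetwork V S) (q : N.Pair → ℕ) (p : N.Pair) : ℕ :=
  if h : (p.2 : ℕ) + 1 < N.hops p.1 then q ⟨p.1, ⟨(p.2 : ℕ) + 1, h⟩⟩ else 0

/-- The queue differential. -/
def queueDiff (N : WirelessNetwork V S) (q : N.Pair → ℕ) (p : N.Pair) : ℤ :=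
  (q p : ℤ) - (N.nextQueue q p : ℤ)

/-- The packets actually transmitted under the schedule `M`: an active link transmits one packet
if its queue is not empty. -/
def transmitted (N : WirelessNetwork V S) (q M : N.Pair → ℕ) (p : N.Pair) : ℕ :=
  min (M p) (q p)

/-- The packets that enter the queue of a link-flow-pair in a slot: the exogenous arrivals at the
first hop, and the packets transmitted by the previous hop at the others. -/
def inflow (N : WirelessNetwork V S) (a : S → ℕ) (q M : N.Pair → ℕ) (p : N.Pair) : ℕ :=
  if (p.2 : ℕ) = 0 then a p.1
  else N.transmitted q M ⟨p.1, ⟨(p.2 : ℕ) - 1, lt_of_le_of_lt (Nat.sub_le _ _) p.2.isLt⟩⟩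

/-- The queue lengths one slot later. -/
def step (N : WirelessNetwork V S) (a : S → ℕ) (q M : N.Pair → ℕ) (p : N.Pair) : ℕ :=
  q p - N.transmitted q M p + N.inflow a q M p

variable [Fintype S]

/-- `M` is a schedule that queue-length-based back-pressure may choose at queue lengths `q`: a
feasible schedule with the largest weight sum of queue differentials (any one of them). -/
def IsBackPressure (N : WirelessNetwork V S) (q M : N.Pair → ℕ) : Prop :=
  M ∈ N.feasible ∧
    ∀ M' ∈ N.feasible, ∑ p, N.queueDiff q p * (M' p : ℤ) ≤ ∑ p, N.queueDiff q p * (M p : ℤ)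

/-- `Q` and `M` are the sample paths of queue lengths and schedules of the network under
queue-length-based back-pressure, with arrivals `a t s` of flow `s` in slot `t`. -/
def IsBackPressurePath (N : WirelessNetwork V S) (a : ℕ → S → ℕ) (Q M : ℕ → N.Pair → ℕ) : Prop :=
  ∀ t, N.IsBackPressure (Q t) (M t) ∧ Q (t + 1) = N.step (a t) (Q t) (M t)

/-- The `L₁`-norm of the vector of queue lengths. -/
def totalQueue (N : WirelessNetwork V S) (q : N.Pair → ℕ) : ℕ := ∑ p, q p

/-- `q` is a fluid limit of the queue lengths under queue-length-based back-pressure along the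
arrival sample path `a`: for some sequence of systems that start with `x n → ∞` packets, the
scaled queue lengths `Q (x t) / x` converge to `q`, uniformly on compact sets of `t ≥ 0`. -/
def IsFluidLimit (N : WirelessNetwork V S) (a : ℕ → S → ℕ) (q : ℝ → N.Pair → ℝ) : Prop :=
  ∃ (x : ℕ → ℕ) (Q M : ℕ → ℕ → N.Pair → ℕ),
    Tendsto x atTop atTop ∧
    (∀ n, N.IsBackPressurePath a (Q n) (M n)) ∧
    (∀ n, N.totalQueue (Q n 0) = x n) ∧
    ∀ R : ℝ, TendstoUniformlyOn
      (fun (n : ℕ) (t : ℝ) (p : N.Pair) => (Q n ⌊(x n : ℝ) * t⌋₊ p : ℝ) / (x n : ℝ))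
      q atTop (Set.Icc 0 R)

/-- The quadratic Lyapunov function. -/
noncomputable def lyapunov (N : WirelessNetwork V S) (q : N.Pair → ℝ) : ℝ :=
  (1 / 2) * ∑ p, q p ^ 2

/-- Stability of the network: `limsup (1/t) ∑_{τ<t} E ‖Q(τ)‖ < ∞`, with expectations in
`[0, ∞]`. -/
def Stable (N : WirelessNetwork V S) {Ω : Type*} [MeasurableSpace Ω] (μ : Measure Ω)
    (Q : ℕ → Ω → N.Pair → ℕ) : Prop :=
  limsup (fun t : ℕ =>
    (∑ τ ∈ Finset.range t, ∫⁻ ω, (N.totalQueue (Q τ ω) : ENNReal) ∂μ) / (t : ENNReal)) atTop < ⊤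

end WirelessNetwork

/-- The arrival processes satisfy the strong law of large numbers with rates `rate`. -/
def SatisfiesSLLN {S Ω : Type*} [MeasurableSpace Ω] (μ : Measure Ω) (A : ℕ → Ω → S → ℕ)
    (rate : S → ℝ) : Prop :=
  ∀ᵐ ω ∂μ, ∀ s, Tendsto
    (fun t : ℕ => (∑ τ ∈ Finset.range t, (A τ ω s : ℝ)) / (t : ℝ)) atTop (𝓝 (rate s))

/-- Arrivals that keep the rates `rate` conditionally on the past, uniformly in time, with bounded
second moments. Here `ℱ t` is the information available when the decision of slot `t` is made, so
the arrivals of slot `t` are known at time `t + 1`. For arrivals that are square-integrable with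
mean `rate`, identically distributed, and independent of the past, this holds with `n = 1`. -/
def KeepsRate {S Ω : Type*} {mΩ : MeasurableSpace Ω} (μ : Measure Ω) (ℱ : Filtration ℕ mΩ)
    (A : ℕ → Ω → S → ℕ) (rate : S → ℝ) : Prop :=
  (∀ t, Measurable[ℱ (t + 1)] (A t)) ∧
  (∃ C : NNReal, ∀ t s, ∫⁻ ω, (A t ω s : ENNReal) ^ 2 ∂μ ≤ C) ∧
  ∀ δ : ℝ, 0 < δ → ∃ n : ℕ, 0 < n ∧ ∀ t s,
    μ[fun ω => ∑ τ ∈ Finset.Ico t (t + n), (A τ ω s : ℝ) | ℱ t] ≤ᵐ[μ]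
      fun _ => (n : ℝ) * (rate s + δ)

/-! Everything rests on one inequality for a single slot. Since `rate` is strictly inside, some `c >
0` leaves room in the convex hull for a virtual service that starts at `rate s + c` and grows by `c`
at every hop. Back-pressure does at least as well as this service, and summation by parts turns the
comparison into a surplus of `c` times the total queue (`StrictlyInside.exists_drain_rate`).

`window_drift` extends this to a window of slots, with weights frozen at the start of the window.
Queues move by at most the window length plus the arrivals, so the error is second order in the
window.

(a) In the fluid scaling this becomes `⟨q t, q t' - q t⟩ ≤ -c (t' - t) ‖q t‖₁ + O((t' - t) ^ 2)`
(`IsFluidLimit.bounds`), so no differential equations for the fluid limit are needed. It gives `V' ≤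
-c ‖q‖₁ ≤ -c √(2V)`, and comparison with an explicit parabola empties the queues by time `2 / c`
(`eq_zero_of_drift`).

(b) For the stochastic network, a window long enough that the conditional arrival rate exceeds
`rate` by at most `c / 2` leaves half of the surplus. Taking expectations and telescoping bounds the
averaged queues (`stable_of_keepsRate`). -/

namespace WirelessNetwork

/-! ### One-slot identities and the drain rate of back-pressure -/

/-- Summation by parts along a route: shifting the flow by one hop amounts to shifting the weights
back. -/
theorem sum_fin_mul_shift {H : ℕ} (hH : 0 < H) (g u : Fin H → ℝ) (a : ℝ) :
    ∑ k : Fin H, g k * (if (k : ℕ) = 0 then a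
        else u ⟨(k : ℕ) - 1, lt_of_le_of_lt (Nat.sub_le _ _) k.isLt⟩) =
      g ⟨0, hH⟩ * a +
        ∑ k : Fin H, (if h : (k : ℕ) + 1 < H then g ⟨(k : ℕ) + 1, h⟩ else 0) * u k := by
  obtain ⟨m, rfl⟩ : ∃ m, H = m + 1 := ⟨H - 1, by omega⟩
  rw [Fin.sum_univ_succ, Fin.sum_univ_castSucc (n := m)]
  simp [Fin.succ, Fin.castSucc, Fin.castAdd, Fin.castLE]

variable {V S : Type*}

/-- The first link of the route of a flow. -/
def firstHop (N : WirelessNetwork V S) (s : S) : N.Pair := ⟨s, ⟨0, N.hops_pos s⟩⟩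

theorem nextQueue_cast (N : WirelessNetwork V S) (q : N.Pair → ℕ) (p : N.Pair) :
    (N.nextQueue q p : ℝ) =
      if h : (p.2 : ℕ) + 1 < N.hops p.1 then (q ⟨p.1, ⟨(p.2 : ℕ) + 1, h⟩⟩ : ℝ) else 0 := by
  unfold nextQueue
  split_ifs <;> simp

theorem transmitted_le_one (N : WirelessNetwork V S) (q : N.Pair → ℕ) {M : N.Pair → ℕ}
    (hM : M ∈ N.feasible) (p : N.Pair) : N.transmitted q M p ≤ 1 := by
  have := hM.1 p
  unfold transmitted
  omega

theorem step_cast (N : WirelessNetwork V S) (a : S → ℕ) (q M : N.Pair → ℕ) (p : N.Pair) :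
    (N.step a q M p : ℝ) = q p - N.transmitted q M p + N.inflow a q M p := by
  have : N.transmitted q M p ≤ q p := min_le_right _ _
  simp [step, Nat.cast_sub this]

variable [Fintype S]

/-- Summation by parts on each route. The weights `w` are kept apart from the state `q` so that they
can later be frozen at the start of a window. -/
theorem sum_mul_inflow (N : WirelessNetwork V S) (a : S → ℕ) (w q M : N.Pair → ℕ) :
    ∑ p, (w p : ℝ) * N.inflow a q M p =
      ∑ s, (w (N.firstHop s) : ℝ) * a s + ∑ p, (N.nextQueue w p : ℝ) * N.transmitted q M p := by
  rw [Fintype.sum_sigma, Fintype.sum_sigma, ← Finset.sum_add_distrib]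
  refine Finset.sum_congr rfl fun s _ => ?_
  have := sum_fin_mul_shift (N.hops_pos s) (fun k => (w ⟨s, k⟩ : ℝ))
    (fun k => (N.transmitted q M ⟨s, k⟩ : ℝ)) (a s)
  simp only [inflow, nextQueue_cast]
  rw [firstHop, ← this]
  refine Finset.sum_congr rfl fun k _ => ?_
  split_ifs <;> rfl

/-- The change of a weighted sum of queue lengths in one slot. -/
theorem sum_mul_step_sub (N : WirelessNetwork V S) (a : S → ℕ) (w q M : N.Pair → ℕ) :
    ∑ p, (w p : ℝ) * ((N.step a q M p : ℝ) - q p) =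
      ∑ s, (w (N.firstHop s) : ℝ) * a s -
        ∑ p, (N.queueDiff w p : ℝ) * N.transmitted q M p := by
  have h := N.sum_mul_inflow a w q M
  simp only [step_cast, queueDiff, Int.cast_sub, Int.cast_natCast, sub_mul,
    Finset.sum_sub_distrib]
  have : ∀ p, (w p : ℝ) * ((q p : ℝ) - N.transmitted q M p + N.inflow a q M p - q p) =
      (w p : ℝ) * N.inflow a q M p - (w p : ℝ) * N.transmitted q M p := fun p => by ring
  simp only [this, Finset.sum_sub_distrib, h]
  ring

/-- A back-pressure schedule transmits at least the positive parts of the queue differentials,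
weighted by any vector of the convex hull. -/
theorem IsBackPressure.sum_max_mul_le {N : WirelessNetwork V S} {q M : N.Pair → ℕ}
    (h : N.IsBackPressure q M) {φ : N.Pair → ℝ} (hφ : φ ∈ N.scheduleHull) :
    ∑ p, max (N.queueDiff q p : ℝ) 0 * φ p ≤
      ∑ p, (N.queueDiff q p : ℝ) * N.transmitted q M p := by
  set B := ∑ p, (N.queueDiff q p : ℝ) * N.transmitted q M p with hB
  -- The bound is linear in `φ`, so it suffices to check it at the schedules themselves.
  have hconv : Convex ℝ {φ : N.Pair → ℝ | ∑ p, max (N.queueDiff q p : ℝ) 0 * φ p ≤ B} := by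
    refine convex_halfSpace_le (IsLinearMap.mk (fun x y => ?_) fun c x => ?_) B
    · simp [mul_add, Finset.sum_add_distrib]
    · simp only [Pi.smul_apply, smul_eq_mul, Finset.mul_sum]
      exact Finset.sum_congr rfl fun _ _ => by ring
  refine convexHull_min ?_ hconv hφ
  rintro _ ⟨M', hM', rfl⟩
  classical
  -- Switching off the links with nonpositive differential keeps a schedule feasible, so the
  -- maximiser also beats this truncation.
  have hfeas : (fun p => if 0 < N.queueDiff q p then M' p else 0) ∈ N.feasible := by
    refine ⟨fun p => ?_, fun p r hpr hp hr => hM'.2 p r hpr ?_ ?_⟩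
    · dsimp only
      split_ifs
      exacts [hM'.1 p, Or.inl rfl]
    · dsimp only at hp
      split_ifs at hp
      exact hp
    · dsimp only at hr
      split_ifs at hr
      exact hr
  have h1 := h.2 _ hfeas
  have h2 : (∑ p, (N.queueDiff q p : ℝ) * ((if 0 < N.queueDiff q p then M' p else 0 : ℕ) : ℝ)) ≤
      ∑ p, (N.queueDiff q p : ℝ) * (M p : ℝ) := by exact_mod_cast h1
  calc ∑ p, max (N.queueDiff q p : ℝ) 0 * (M' p : ℝ)
      = ∑ p, (N.queueDiff q p : ℝ) * ((if 0 < N.queueDiff q p then M' p else 0 : ℕ) : ℝ) := by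
        refine Finset.sum_congr rfl fun p _ => ?_
        split_ifs with hp
        · rw [max_eq_left (by exact_mod_cast hp.le)]
        · rw [max_eq_right (by exact_mod_cast not_lt.1 hp)]
          simp
    _ ≤ ∑ p, (N.queueDiff q p : ℝ) * (M p : ℝ) := h2
    _ ≤ B := by
        -- Scheduled and actual transmissions differ only at an empty queue, where the differential
        -- is nonpositive, so losing the transmission does not lower the sum.
        refine Finset.sum_le_sum fun p _ => ?_
        rcases Nat.eq_zero_or_pos (q p) with hq | hq
        · have : (N.queueDiff q p : ℝ) ≤ 0 := by simp [queueDiff, hq]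
          simp only [transmitted, hq, Nat.min_zero, Nat.cast_zero, mul_zero]
          exact mul_nonpos_of_nonpos_of_nonneg this (Nat.cast_nonneg _)
        · have : N.transmitted q M p = M p := by
            have := h.1.1 p
            unfold transmitted
            omega
          rw [this]

/-- Back-pressure drains all the queues at a uniform rate, on top of the arrival rates. -/
theorem StrictlyInside.exists_drain_rate {N : WirelessNetwork V S} {rate : S → ℝ}
    (hrate : N.StrictlyInside rate) :
    ∃ c : ℝ, 0 < c ∧ ((∀ s, 0 ≤ rate s) → ∀ q M, N.IsBackPressure q M →
      ∑ s, rate s * q (N.firstHop s) + c * ∑ p, (q p : ℝ) ≤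
        ∑ p, (N.queueDiff q p : ℝ) * N.transmitted q M p) := by
  obtain ⟨φ, hφ, hlt⟩ := hrate
  -- The slack `φ p - rate p.1` is positive at each of finitely many pairs, so a small `c` fits at
  -- all hops. It is chosen before any sign condition on `rate`, hence depends on the network and
  -- the rates alone.
  have hev : ∀ᶠ c : ℝ in 𝓝[>] 0, ∀ p : N.Pair, rate p.1 + c * ((p.2 : ℕ) + 1) ≤ φ p := by
    refine eventually_all.2 fun p => ?_
    have : Tendsto (fun c : ℝ => rate p.1 + c * ((p.2 : ℕ) + 1)) (𝓝[>] 0)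
        (𝓝 (rate p.1 + 0 * ((p.2 : ℕ) + 1))) := by
      refine Tendsto.mono_left (Continuous.tendsto ?_ 0) nhdsWithin_le_nhds
      fun_prop
    exact this.eventually_le_const (by simpa using hlt p)
  obtain ⟨c, hc, hc0⟩ := (hev.and self_mem_nhdsWithin).exists
  have hc0 : 0 < c := hc0
  refine ⟨c, hc0, fun hpos q M h => ?_⟩
  -- The virtual service increases by `c` at each hop, counting `rate s` as the service before the
  -- first one. Summation by parts therefore gives every queue the coefficient `c`, plus `rate s` at
  -- the first hop.
  suffices hsum : ∑ s, rate s * q (N.firstHop s) + c * ∑ p, (q p : ℝ) =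
      ∑ p : N.Pair, (N.queueDiff q p : ℝ) * (rate p.1 + c * ((p.2 : ℕ) + 1)) by
    rw [hsum]
    refine le_trans (Finset.sum_le_sum fun p _ => ?_) (h.sum_max_mul_le hφ)
    have h0 : 0 ≤ rate p.1 + c * ((p.2 : ℕ) + 1) := by have := hpos p.1; positivity
    exact mul_le_mul (le_max_left _ _) (hc p) h0 (le_max_right _ _)
  rw [Fintype.sum_sigma, Fintype.sum_sigma, Finset.mul_sum, ← Finset.sum_add_distrib]
  refine Finset.sum_congr rfl fun s _ => ?_
  have := sum_fin_mul_shift (N.hops_pos s) (fun k => (q ⟨s, k⟩ : ℝ))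
    (fun k => rate s + c * ((k : ℕ) + 1)) (rate s)
  simp only [queueDiff, Int.cast_sub, Int.cast_natCast, sub_mul, Finset.sum_sub_distrib,
    nextQueue_cast]
  rw [eq_sub_iff_add_eq, firstHop, mul_comm (rate s), add_right_comm, ← this, Finset.mul_sum,
    ← Finset.sum_add_distrib]
  refine Finset.sum_congr rfl fun k _ => ?_
  split_ifs with hk
  · rw [hk]; push_cast; ring
  · rw [Nat.cast_sub (by omega)]; push_cast; ring

/-! ### Drift along a sample path over a window of slots -/

namespace IsBackPressurePath

variable {N : WirelessNetwork V S} {a : ℕ → S → ℕ} {Q M : ℕ → N.Pair → ℕ}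

theorem abs_succ_sub_le (h : N.IsBackPressurePath a Q M) (t : ℕ) (p : N.Pair) :
    |(Q (t + 1) p : ℝ) - Q t p| ≤ 1 + ∑ s, (a t s : ℝ) := by
  have h1 : (N.transmitted (Q t) (M t) p : ℝ) ≤ 1 := by
    exact_mod_cast N.transmitted_le_one _ (h t).1.1 p
  have hs : ∀ s, (a t s : ℝ) ≤ ∑ s, (a t s : ℝ) := fun s =>
    Finset.single_le_sum (f := fun s => (a t s : ℝ)) (fun _ _ => Nat.cast_nonneg _)
      (Finset.mem_univ s)
  have h2 : (N.inflow (a t) (Q t) (M t) p : ℝ) ≤ 1 + ∑ s, (a t s : ℝ) := by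
    unfold inflow
    split_ifs
    · linarith [hs p.1]
    · have : (0 : ℝ) ≤ ∑ s, (a t s : ℝ) := Finset.sum_nonneg fun _ _ => Nat.cast_nonneg _
      have h3 : ∀ r, (N.transmitted (Q t) (M t) r : ℝ) ≤ 1 := fun r => by
        exact_mod_cast N.transmitted_le_one _ (h t).1.1 r
      linarith [h3 ⟨p.1, ⟨(p.2 : ℕ) - 1, lt_of_le_of_lt (Nat.sub_le _ _) p.2.isLt⟩⟩]
  have h3 : (0 : ℝ) ≤ N.transmitted (Q t) (M t) p := Nat.cast_nonneg _
  have h4 : (0 : ℝ) ≤ N.inflow (a t) (Q t) (M t) p := Nat.cast_nonneg _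
  have h5 : (0 : ℝ) ≤ ∑ s, (a t s : ℝ) := Finset.sum_nonneg fun _ _ => Nat.cast_nonneg _
  rw [(h t).2, step_cast, abs_le]
  constructor <;> linarith

/-- Queue lengths change by at most the number of slots plus the number of arrivals. -/
theorem abs_sub_le (h : N.IsBackPressurePath a Q M) {i j : ℕ} (hij : i ≤ j) (p : N.Pair) :
    |(Q j p : ℝ) - Q i p| ≤ ((j : ℝ) - i) + ∑ s, ∑ τ ∈ Finset.Ico i j, (a τ s : ℝ) := by
  induction j, hij using Nat.le_induction with
  | base => simp
  | succ j hij ih =>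
    have h1 := h.abs_succ_sub_le j p
    have h2 : |(Q (j + 1) p : ℝ) - Q i p| ≤
        |(Q (j + 1) p : ℝ) - Q j p| + |(Q j p : ℝ) - Q i p| := _root_.abs_sub_le _ _ _
    simp only [Finset.sum_Ico_succ_top hij, Finset.sum_add_distrib]
    push_cast
    linarith

theorem abs_sub_le_of_le (h : N.IsBackPressurePath a Q M) {i τ j : ℕ} (hi : i ≤ τ) (hj : τ ≤ j)
    (p : N.Pair) :
    |(Q τ p : ℝ) - Q i p| ≤ ((j : ℝ) - i) + ∑ s, ∑ τ ∈ Finset.Ico i j, (a τ s : ℝ) := by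
  refine (h.abs_sub_le hi p).trans (add_le_add ?_ (Finset.sum_le_sum fun s _ => ?_))
  · have : (τ : ℝ) ≤ j := by exact_mod_cast hj
    linarith
  · exact Finset.sum_le_sum_of_subset_of_nonneg (Finset.Ico_subset_Ico_right hj)
      fun _ _ _ => Nat.cast_nonneg _

/-- The drift of the queue lengths over a window, weighted by the queue lengths at its start. -/
theorem window_drift (h : N.IsBackPressurePath a Q M) {rate : S → ℝ} {c : ℝ} (hc : 0 ≤ c)
    (hpos : ∀ s, 0 ≤ rate s)
    (hdrain : ∀ q M, N.IsBackPressure q M →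
      ∑ s, rate s * q (N.firstHop s) + c * ∑ p, (q p : ℝ) ≤
        ∑ p, (N.queueDiff q p : ℝ) * N.transmitted q M p)
    {i j : ℕ} (hij : i ≤ j) :
    ∑ p, (Q i p : ℝ) * ((Q j p : ℝ) - Q i p) ≤
      ∑ s, (Q i (N.firstHop s) : ℝ) *
          (∑ τ ∈ Finset.Ico i j, (a τ s : ℝ) - ((j : ℝ) - i) * rate s)
        - ((j : ℝ) - i) * (c * ∑ p, (Q i p : ℝ))
        + ((j : ℝ) - i) * ((2 * Fintype.card N.Pair + ∑ s, rate s + c * Fintype.card N.Pair) *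
          (((j : ℝ) - i) + ∑ s, ∑ τ ∈ Finset.Ico i j, (a τ s : ℝ))) := by
  set η := ((j : ℝ) - i) + ∑ s, ∑ τ ∈ Finset.Ico i j, (a τ s : ℝ) with hη
  set K : ℝ := 2 * Fintype.card N.Pair + ∑ s, rate s + c * Fintype.card N.Pair with hK
  have hη0 : 0 ≤ η := by
    have : (i : ℝ) ≤ j := by exact_mod_cast hij
    have : (0 : ℝ) ≤ ∑ s, ∑ τ ∈ Finset.Ico i j, (a τ s : ℝ) :=
      Finset.sum_nonneg fun _ _ => Finset.sum_nonneg fun _ _ => Nat.cast_nonneg _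
    linarith
  -- The drain inequality holds with weights `Q τ`, while the sum has weights `Q i`. Exchanging them
  -- costs `2 * η` per pair in the differentials, `rate s * η` per flow and `c * η` per pair in the
  -- drain, which together make `K * η`.
  have hslot : ∀ τ ∈ Finset.Ico i j,
      ∑ p, (Q i p : ℝ) * ((Q (τ + 1) p : ℝ) - Q τ p) ≤
        ∑ s, (Q i (N.firstHop s) : ℝ) * a τ s - ∑ s, rate s * Q i (N.firstHop s) -
          c * ∑ p, (Q i p : ℝ) + K * η := by
    intro τ hτ
    rw [Finset.mem_Ico] at hτ
    have hclose : ∀ p, |(Q τ p : ℝ) - Q i p| ≤ η := h.abs_sub_le_of_le hτ.1 hτ.2.le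
    have hnext : ∀ p, |(N.nextQueue (Q τ) p : ℝ) - N.nextQueue (Q i) p| ≤ η := by
      intro p
      simp only [nextQueue_cast]
      split_ifs
      · exact hclose _
      · simpa using hη0
    rw [(h τ).2, N.sum_mul_step_sub]
    have h1 := hdrain _ _ (h τ).1
    have h2 : ∑ p, (N.queueDiff (Q τ) p : ℝ) * N.transmitted (Q τ) (M τ) p ≤
        ∑ p, ((N.queueDiff (Q i) p : ℝ) * N.transmitted (Q τ) (M τ) p + 2 * η) := by
      refine Finset.sum_le_sum fun p _ => ?_
      have h3 : (N.transmitted (Q τ) (M τ) p : ℝ) ≤ 1 := by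
        exact_mod_cast N.transmitted_le_one _ (h τ).1.1 p
      have h4 : (0 : ℝ) ≤ N.transmitted (Q τ) (M τ) p := Nat.cast_nonneg _
      have h5 : (N.queueDiff (Q τ) p : ℝ) - N.queueDiff (Q i) p ≤ 2 * η := by
        simp only [queueDiff, Int.cast_sub, Int.cast_natCast]
        linarith [(abs_le.1 (hclose p)).2, (abs_le.1 (hnext p)).1]
      nlinarith [mul_le_mul_of_nonneg_right h5 h4, mul_le_mul_of_nonneg_left h3 hη0]
    have h6 : ∑ s, rate s * Q i (N.firstHop s) ≤
        ∑ s, (rate s * Q τ (N.firstHop s) + rate s * η) := by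
      refine Finset.sum_le_sum fun s _ => ?_
      rw [← mul_add]
      exact mul_le_mul_of_nonneg_left
        (by linarith [(abs_le.1 (hclose (N.firstHop s))).1]) (hpos s)
    have h7 : ∑ p, (Q i p : ℝ) ≤ ∑ p, ((Q τ p : ℝ) + η) :=
      Finset.sum_le_sum fun p _ => by linarith [(abs_le.1 (hclose p)).1]
    have h8 := mul_le_mul_of_nonneg_left h7 hc
    simp only [Finset.sum_add_distrib, Finset.sum_const, Finset.card_univ, nsmul_eq_mul,
      ← Finset.sum_mul] at h2 h6 h8
    rw [hK]
    linarith
  have hsum := Finset.sum_le_sum hslot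
  rw [Finset.sum_comm] at hsum
  have htel : ∀ p, ∑ τ ∈ Finset.Ico i j, (Q i p : ℝ) * ((Q (τ + 1) p : ℝ) - Q τ p) =
      (Q i p : ℝ) * ((Q j p : ℝ) - Q i p) := fun p => by
    rw [← Finset.mul_sum, Finset.sum_Ico_sub (fun τ => (Q τ p : ℝ)) hij]
  simp only [htel, Finset.sum_add_distrib, Finset.sum_sub_distrib, Finset.sum_const,
    Nat.card_Ico, nsmul_eq_mul, Nat.cast_sub hij] at hsum
  rw [Finset.sum_comm] at hsum
  simp only [mul_sub, Finset.sum_sub_distrib, Finset.mul_sum] at hsum ⊢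
  refine hsum.trans (le_of_eq ?_)
  congr 3
  exact Finset.sum_congr rfl fun s _ => by ring

end IsBackPressurePath

end WirelessNetwork
-- Cumulative arrivals in the fluid scaling
theorem tendsto_sum_range_floor_div {f : ℕ → ℝ} {r : ℝ}
    (hf : Tendsto (fun t : ℕ => (∑ τ ∈ Finset.range t, f τ) / (t : ℝ)) atTop (𝓝 r))
    {x : ℕ → ℕ} (hx : Tendsto x atTop atTop) {t : ℝ} (ht : 0 ≤ t) :
    Tendsto (fun n => (∑ τ ∈ Finset.range ⌊(x n : ℝ) * t⌋₊, f τ) / (x n : ℝ)) atTop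
      (𝓝 (r * t)) := by
  -- Time zero is separate: there the number of slots stays zero and the Cesàro limit does not
  -- apply.
  rcases ht.eq_or_lt with rfl | ht0
  · simp
  have hx' : Tendsto (fun n => (x n : ℝ)) atTop atTop := tendsto_natCast_atTop_atTop.comp hx
  have h1 : Tendsto (fun n => ⌊(x n : ℝ) * t⌋₊) atTop atTop :=
    tendsto_nat_floor_atTop.comp (hx'.atTop_mul_const ht0)
  have h2 : Tendsto (fun n => (⌊(x n : ℝ) * t⌋₊ : ℝ) / (x n : ℝ)) atTop (𝓝 t) := by
    simpa only [mul_comm, Function.comp_def] using (tendsto_nat_floor_mul_div_atTop ht).comp hx'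
  refine ((hf.comp h1).mul h2).congr fun n => ?_
  rcases Nat.eq_zero_or_pos ⌊(x n : ℝ) * t⌋₊ with h0 | h0
  · simp [h0]
  · have : (⌊(x n : ℝ) * t⌋₊ : ℝ) ≠ 0 := by exact_mod_cast h0.ne'
    simp only [Function.comp_def]
    field_simp

/-! ### Deterministic paths with an integrated drift inequality -/

section Drift

variable {ι : Type*} [Fintype ι] {q : ℝ → ι → ℝ} {c C L : ℝ}

/-- Expanding the square leaves the drift term plus half the squared increment, which the Lipschitz
bound makes quadratic in `t' - t`. No differentiability is needed, so the estimate also serves the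
comparison argument. -/
theorem slope_sq_le_of_drift
    (hlip : ∀ t t', 0 ≤ t → t ≤ t' → ∀ p, |q t' p - q t p| ≤ L * (t' - t))
    (hdrift : ∀ t t', 0 ≤ t → t ≤ t' →
      ∑ p, q t p * (q t' p - q t p) ≤ -(t' - t) * (c * ∑ p, q t p) + C * (t' - t) ^ 2)
    {t t' : ℝ} (ht : 0 ≤ t) (htt' : t < t') :
    slope (fun r => (1 / 2) * ∑ p, q r p ^ 2) t t' ≤
      -(c * ∑ p, q t p) + (C + Fintype.card ι * L ^ 2) * (t' - t) := by
  have hpos : 0 < t' - t := sub_pos.2 htt'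
  have h1 : ∑ p, (q t' p - q t p) ^ 2 ≤ ∑ _p : ι, (L * (t' - t)) ^ 2 :=
    Finset.sum_le_sum fun p _ => sq_le_sq.2 ((hlip t t' ht htt'.le p).trans (le_abs_self _))
  have h0 : (0 : ℝ) ≤ ∑ p, (q t' p - q t p) ^ 2 := Finset.sum_nonneg fun _ _ => sq_nonneg _
  simp only [Finset.sum_const, Finset.card_univ, nsmul_eq_mul] at h1
  have h2 : (1 / 2) * ∑ p, q t' p ^ 2 - (1 / 2) * ∑ p, q t p ^ 2 =
      ∑ p, q t p * (q t' p - q t p) + (1 / 2) * ∑ p, (q t' p - q t p) ^ 2 := by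
    simp only [Finset.mul_sum, ← Finset.sum_sub_distrib, ← Finset.sum_add_distrib]
    exact Finset.sum_congr rfl fun p _ => by ring
  rw [slope_def_field, div_le_iff₀ hpos, h2]
  nlinarith [hdrift t t' ht htt'.le]

theorem derivWithin_sq_le_of_drift
    (hlip : ∀ t t', 0 ≤ t → t ≤ t' → ∀ p, |q t' p - q t p| ≤ L * (t' - t))
    (hdrift : ∀ t t', 0 ≤ t → t ≤ t' →
      ∑ p, q t p * (q t' p - q t p) ≤ -(t' - t) * (c * ∑ p, q t p) + C * (t' - t) ^ 2)
    {t : ℝ} (ht : 0 ≤ t) (hq : DifferentiableWithinAt ℝ q (Set.Ici t) t) :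
    derivWithin (fun r => (1 / 2) * ∑ p, q r p ^ 2) (Set.Ici t) t ≤ -(c * ∑ p, q t p) := by
  have hq' := differentiableWithinAt_pi.1 hq
  have hV : DifferentiableWithinAt ℝ (fun r => (1 / 2) * ∑ p, q r p ^ 2) (Set.Ici t) t :=
    (DifferentiableWithinAt.fun_sum fun p _ => (hq' p).pow 2).const_mul _
  have hV' := (hV.hasDerivWithinAt.mono Set.Ioi_subset_Ici_self)
  rw [hasDerivWithinAt_iff_tendsto_slope' (by simp)] at hV'
  have hlim : Tendsto (fun t' => -(c * ∑ p, q t p) + (C + Fintype.card ι * L ^ 2) * (t' - t))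
      (𝓝[>] t) (𝓝 (-(c * ∑ p, q t p) + (C + Fintype.card ι * L ^ 2) * (t - t))) :=
    (Continuous.tendsto (by fun_prop) t).mono_left nhdsWithin_le_nhds
  rw [sub_self, mul_zero, add_zero] at hlim
  refine le_of_tendsto_of_tendsto hV' hlim ?_
  filter_upwards [self_mem_nhdsWithin] with t' ht'
  exact slope_sq_le_of_drift hlip hdrift ht ht'

theorem lipschitzOnWith_of_abs_le (hL : 0 ≤ L)
    (hlip : ∀ t t', 0 ≤ t → t ≤ t' → ∀ p, |q t' p - q t p| ≤ L * (t' - t)) :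
    LipschitzOnWith L.toNNReal q (Set.Ici 0) := by
  refine LipschitzOnWith.of_dist_le_mul fun t ht t' ht' => ?_
  rw [Real.coe_toNNReal _ hL]
  refine (dist_pi_le_iff (by positivity)).2 fun p => ?_
  rcases le_total t t' with h | h
  · rw [dist_comm, dist_comm t, Real.dist_eq, Real.dist_eq, abs_of_nonneg (sub_nonneg.2 h)]
    exact hlip t t' ht h p
  · rw [Real.dist_eq, Real.dist_eq, abs_of_nonneg (sub_nonneg.2 h)]
    exact hlip t' t ht' h p

/-- A nonnegative Lipschitz path whose quadratic Lyapunov function decreases at rate `c` times its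
`L₁`-norm reaches zero by time `2 / c` and stays there. -/
theorem eq_zero_of_drift (hc : 0 < c) (hL : 0 ≤ L) (hnonneg : ∀ t, 0 ≤ t → ∀ p, 0 ≤ q t p)
    (hlip : ∀ t t', 0 ≤ t → t ≤ t' → ∀ p, |q t' p - q t p| ≤ L * (t' - t))
    (hdrift : ∀ t t', 0 ≤ t → t ≤ t' →
      ∑ p, q t p * (q t' p - q t p) ≤ -(t' - t) * (c * ∑ p, q t p) + C * (t' - t) ^ 2)
    (hinit : ∑ p, q 0 p ≤ 1) {t : ℝ} (ht : 2 / c ≤ t) : q t = 0 := by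
  set f : ℝ → ℝ := fun r => (1 / 2) * ∑ p, q r p ^ 2 with hf
  have hcont : ContinuousOn q (Set.Ici 0) := (lipschitzOnWith_of_abs_le hL hlip).continuousOn
  have hfcont : ContinuousOn f (Set.Ici 0) :=
    continuousOn_const.mul (continuousOn_finsetSum _ fun p _ =>
      (continuousOn_pi.1 hcont p).pow 2)
  have hslope : ∀ x, 0 ≤ x → ∀ r, -(c * ∑ p, q x p) < r → ∃ᶠ z in 𝓝[>] x, slope f x z < r := by
    intro x hx r hr
    have hlim : Tendsto (fun t' => -(c * ∑ p, q x p) + (C + Fintype.card ι * L ^ 2) * (t' - x))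
        (𝓝[>] x) (𝓝 (-(c * ∑ p, q x p) + (C + Fintype.card ι * L ^ 2) * (x - x))) :=
      (Continuous.tendsto (by fun_prop) x).mono_left nhdsWithin_le_nhds
    rw [sub_self, mul_zero, add_zero] at hlim
    refine Eventually.frequently ?_
    filter_upwards [self_mem_nhdsWithin, hlim.eventually_lt_const hr] with z hz hzr
    exact (slope_sq_le_of_drift hlip hdrift hx hz).trans_lt hzr
  have hsq : ∀ x, 0 ≤ x → 2 * f x ≤ (∑ p, q x p) ^ 2 := fun x hx => by
    have := Finset.sum_sq_le_sq_sum_of_nonneg (s := Finset.univ) (f := q x) fun p _ => hnonneg x hx p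
    simp only [hf]
    linarith
  have hsum : ∀ x, 0 ≤ x → 0 ≤ ∑ p, q x p := fun x hx =>
    Finset.sum_nonneg fun p _ => hnonneg x hx p
  have hT : 0 ≤ 2 / c := by positivity
  have hzero : f (2 / c) ≤ 0 := by
    -- The barrier solves `B' = -(c / 2) * √(2 * B)` and vanishes at `2 / c`. Half of the available
    -- rate is given up because the comparison requires a strict inequality at contact.
    have := image_le_of_liminf_slope_right_lt_deriv_boundary' (a := 0) (b := 2 / c)
      (f := f) (f' := fun x => -(c * ∑ p, q x p)) (B := fun x => (1 / 2) * (1 - c / 2 * x) ^ 2)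
      (B' := fun x => -(c / 2 * (1 - c / 2 * x)))
      (hfcont.mono Set.Icc_subset_Ici_self) (fun x hx => hslope x hx.1)
      (by have := hsq 0 le_rfl; have := hsum 0 le_rfl; nlinarith)
      (by fun_prop)
      (fun x _ => by
        have h := (((hasDerivAt_id x).const_mul (c / 2)).const_sub 1).pow 2 |>.const_mul (1 / 2 : ℝ)
        refine (h.congr_deriv ?_).hasDerivWithinAt
        simp only [id]
        push_cast
        ring)
      (fun x hx hfx => by
        have hx1 : 0 < 1 - c / 2 * x := by
          have := hx.2
          rw [lt_div_iff₀ hc] at this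
          linarith
        have h1 := hsq x hx.1
        rw [hfx] at h1
        have h2 : 1 - c / 2 * x ≤ ∑ p, q x p :=
          (sq_le_sq₀ hx1.le (hsum x hx.1)).1 (by linarith)
        nlinarith)
      (Set.right_mem_Icc.2 hT)
    refine this.trans (le_of_eq ?_)
    field_simp
    ring
  have hle : f t ≤ 0 := by
    -- Past `2 / c` every constant level `ε > 0` is a barrier: on contact `V = ε`, the queues are
    -- nonzero and the drift is strictly negative.
    refine le_of_forall_pos_le_add fun ε hε => ?_
    rw [zero_add]
    exact image_le_of_liminf_slope_right_lt_deriv_boundary' (a := 2 / c) (b := t)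
      (f := f) (f' := fun x => -(c * ∑ p, q x p)) (B := fun _ => ε) (B' := fun _ => 0)
      (hfcont.mono fun x hx => hT.trans hx.1) (fun x hx => hslope x (hT.trans hx.1))
      (hzero.trans hε.le) continuousOn_const (fun x _ => hasDerivWithinAt_const _ _ _)
      (fun x hx hfx => by
        have h1 := hsq x (hT.trans hx.1)
        rw [hfx] at h1
        have h2 : 0 < ∑ p, q x p := by
          refine lt_of_le_of_ne (hsum x (hT.trans hx.1)) fun h => ?_
          rw [← h] at h1
          linarith
        have := mul_pos hc h2
        linarith)
      (Set.right_mem_Icc.2 ht)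
  have h0 : ∑ p, q t p ^ 2 = 0 := by
    refine le_antisymm ?_ (Finset.sum_nonneg fun _ _ => sq_nonneg _)
    simp only [hf] at hle
    linarith
  ext p
  have := (Finset.sum_eq_zero_iff_of_nonneg fun p _ => sq_nonneg (q t p)).1 h0 p
    (Finset.mem_univ p)
  simpa using this

end Drift

/-! ### Passage to the fluid limit -/

namespace WirelessNetwork

variable {V S : Type*} [Fintype S] {N : WirelessNetwork V S} {a : ℕ → S → ℕ} {q : ℝ → N.Pair → ℝ}

/-- The fluid limits are nonnegative, start with one unit of fluid, are Lipschitz, and satisfy an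
integrated drift inequality. -/
theorem IsFluidLimit.bounds (h : N.IsFluidLimit a q) {rate : S → ℝ} {c : ℝ} (hc : 0 ≤ c)
    (hpos : ∀ s, 0 ≤ rate s)
    (hdrain : ∀ q M, N.IsBackPressure q M →
      ∑ s, rate s * q (N.firstHop s) + c * ∑ p, (q p : ℝ) ≤
        ∑ p, (N.queueDiff q p : ℝ) * N.transmitted q M p)
    (ha : ∀ s, Tendsto (fun t : ℕ => (∑ τ ∈ Finset.range t, (a τ s : ℝ)) / (t : ℝ)) atTop
      (𝓝 (rate s))) :
    (∀ t, 0 ≤ t → ∀ p, 0 ≤ q t p) ∧ (∑ p, q 0 p = 1) ∧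
    (∀ t t', 0 ≤ t → t ≤ t' → ∀ p, |q t' p - q t p| ≤ (1 + ∑ s, rate s) * (t' - t)) ∧
    (∀ t t', 0 ≤ t → t ≤ t' →
      ∑ p, q t p * (q t' p - q t p) ≤ -(t' - t) * (c * ∑ p, q t p) +
        ((2 * Fintype.card N.Pair + ∑ s, rate s + c * Fintype.card N.Pair) *
          (1 + ∑ s, rate s)) * (t' - t) ^ 2) := by
  obtain ⟨x, Q, M, hx, hpath, hinit, hunif⟩ := h
  have hx' : Tendsto (fun n => (x n : ℝ)) atTop atTop := tendsto_natCast_atTop_atTop.comp hx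
  have hx0 : ∀ᶠ n in atTop, (0 : ℝ) < x n := hx'.eventually_gt_atTop 0
  have hQ : ∀ t, 0 ≤ t → ∀ p,
      Tendsto (fun n => (Q n ⌊(x n : ℝ) * t⌋₊ p : ℝ) / (x n : ℝ)) atTop (𝓝 (q t p)) :=
    fun t ht => tendsto_pi_nhds.1 ((hunif t).tendsto_at (Set.right_mem_Icc.2 ht))
  have hfloor : ∀ t, 0 ≤ t →
      Tendsto (fun n => (⌊(x n : ℝ) * t⌋₊ : ℝ) / (x n : ℝ)) atTop (𝓝 t) := fun t ht => by
    simpa only [mul_comm, Function.comp_def] using (tendsto_nat_floor_mul_div_atTop ht).comp hx'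
  have hmono : ∀ t t' : ℝ, t ≤ t' → ∀ n, ⌊(x n : ℝ) * t⌋₊ ≤ ⌊(x n : ℝ) * t'⌋₊ :=
    fun t t' htt' n => Nat.floor_mono (mul_le_mul_of_nonneg_left htt' (Nat.cast_nonneg _))
  have hlen : ∀ t t', 0 ≤ t → t ≤ t' → Tendsto
      (fun n => ((⌊(x n : ℝ) * t'⌋₊ : ℝ) - ⌊(x n : ℝ) * t⌋₊) / (x n : ℝ)) atTop (𝓝 (t' - t)) :=
    fun t t' ht htt' => ((hfloor t' (ht.trans htt')).sub (hfloor t ht)).congr fun n =>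
      (sub_div _ _ _).symm
  have harr : ∀ t t', 0 ≤ t → t ≤ t' → ∀ s, Tendsto
      (fun n => (∑ τ ∈ Finset.Ico ⌊(x n : ℝ) * t⌋₊ ⌊(x n : ℝ) * t'⌋₊, (a τ s : ℝ)) / (x n : ℝ))
      atTop (𝓝 (rate s * (t' - t))) := fun t t' ht htt' s => by
    rw [mul_sub]
    refine ((tendsto_sum_range_floor_div (ha s) hx (ht.trans htt')).sub
      (tendsto_sum_range_floor_div (ha s) hx ht)).congr fun n => ?_
    rw [Finset.sum_Ico_eq_sub _ (hmono t t' htt' n), sub_div]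
  have hchange : ∀ t t', 0 ≤ t → t ≤ t' → Tendsto
      (fun n => (((⌊(x n : ℝ) * t'⌋₊ : ℝ) - ⌊(x n : ℝ) * t⌋₊) +
        ∑ s, ∑ τ ∈ Finset.Ico ⌊(x n : ℝ) * t⌋₊ ⌊(x n : ℝ) * t'⌋₊, (a τ s : ℝ)) / (x n : ℝ))
      atTop (𝓝 ((1 + ∑ s, rate s) * (t' - t))) := fun t t' ht htt' => by
    rw [add_mul, one_mul, Finset.sum_mul]
    refine ((hlen t t' ht htt').add (tendsto_finsetSum _ fun s _ => harr t t' ht htt' s)).congr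
      fun n => ?_
    rw [add_div, Finset.sum_div]
  refine ⟨fun t ht p => ?_, ?_, fun t t' ht htt' p => ?_, fun t t' ht htt' => ?_⟩
  · exact ge_of_tendsto' (hQ t ht p) fun n => by positivity
  · refine tendsto_nhds_unique (tendsto_finsetSum _ fun p _ => hQ 0 le_rfl p)
      (tendsto_const_nhds.congr' ?_)
    filter_upwards [hx0] with n hn
    have := hinit n
    unfold totalQueue at this
    simp only [mul_zero, Nat.floor_zero]
    rw [← Finset.sum_div, ← Nat.cast_sum, this, div_self hn.ne']
  · refine le_of_tendsto_of_tendsto ((hQ t' (ht.trans htt') p).sub (hQ t ht p)).abs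
      (hchange t t' ht htt') ?_
    filter_upwards [hx0] with n hn
    rw [← sub_div, abs_div, abs_of_pos hn]
    exact div_le_div_of_nonneg_right ((hpath n).abs_sub_le (hmono t t' htt' n) p) hn.le
  · set K : ℝ := 2 * Fintype.card N.Pair + ∑ s, rate s + c * Fintype.card N.Pair with hK
    have hl : Tendsto (fun n => ∑ p, (Q n ⌊(x n : ℝ) * t⌋₊ p : ℝ) / (x n : ℝ) *
        ((Q n ⌊(x n : ℝ) * t'⌋₊ p : ℝ) / (x n : ℝ) - (Q n ⌊(x n : ℝ) * t⌋₊ p : ℝ) / (x n : ℝ)))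
        atTop (𝓝 (∑ p, q t p * (q t' p - q t p))) :=
      tendsto_finsetSum _ fun p _ => (hQ t ht p).mul ((hQ t' (ht.trans htt') p).sub (hQ t ht p))
    have hr1 := tendsto_finsetSum Finset.univ fun (s : S) _ =>
      (hQ t ht (N.firstHop s)).mul ((harr t t' ht htt' s).sub
        ((hlen t t' ht htt').mul_const (rate s)))
    have hr2 := (hlen t t' ht htt').mul
      ((tendsto_finsetSum Finset.univ fun p _ => hQ t ht p).const_mul c)
    have hr3 := (hlen t t' ht htt').mul ((hchange t t' ht htt').const_mul K)
    refine (le_of_tendsto_of_tendsto hl ((hr1.sub hr2).add hr3) ?_).trans (le_of_eq ?_)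
    · filter_upwards [hx0] with n hn
      -- Queue lengths, window length and arrivals are all of order `x n`, so both sides are divided
      -- by its square.
      have hw := div_le_div_of_nonneg_right
        ((hpath n).window_drift hc hpos hdrain (hmono t t' htt' n)) (sq_nonneg (x n : ℝ))
      refine (le_of_eq ?_).trans (hw.trans (le_of_eq ?_))
      · rw [Finset.sum_div]
        refine Finset.sum_congr rfl fun p _ => ?_
        field_simp
      · rw [← hK, add_div, sub_div, Finset.sum_div, ← Finset.sum_div (Finset.univ : Finset N.Pair)]
        congr 1
        · congr 1
          · refine Finset.sum_congr rfl fun s _ => ?_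
            field_simp
          · field_simp
        · field_simp
    -- The law of large numbers cancels the arrival fluctuations in the limit.
    · have : ∀ s, q t (N.firstHop s) * (rate s * (t' - t) - (t' - t) * rate s) = 0 := fun s => by
        ring
      simp only [this, Finset.sum_const_zero]
      ring

end WirelessNetwork
-- Telescoping and conditional expectation tools
/-- Telescoping of an `n`-step drift inequality. -/
theorem sum_range_le_of_drift {v z : ℕ → ℝ} {κ B : ℝ} {n : ℕ} (hv : ∀ t, 0 ≤ v t)
    (h : ∀ t, v (t + n) + κ * z t ≤ v t + B) (T : ℕ) :
    κ * ∑ t ∈ Finset.range T, z t ≤ ∑ i ∈ Finset.range n, v i + T * B := by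
  have h1 := Finset.sum_le_sum fun t (_ : t ∈ Finset.range T) => h t
  simp only [Finset.sum_add_distrib, Finset.sum_const, Finset.card_range, nsmul_eq_mul,
    ← Finset.mul_sum] at h1
  have h2 : ∑ t ∈ Finset.range T, v t ≤ ∑ t ∈ Finset.range (n + T), v t :=
    Finset.sum_le_sum_of_subset_of_nonneg (Finset.range_mono (Nat.le_add_left _ _))
      fun _ _ _ => hv _
  rw [Finset.sum_range_add] at h2
  simp only [add_comm n] at h2
  linarith

theorem measurable_natCast_apply {Ω ι : Type*} {m : MeasurableSpace Ω} {X : Ω → ι → ℕ}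
    (hX : Measurable X) (i : ι) : Measurable fun ω => (X ω i : ℝ) :=
  measurable_from_top.comp ((measurable_pi_apply i).comp hX)

theorem integrable_natCast_sq {Ω : Type*} [MeasurableSpace Ω] {μ : Measure Ω} {X : Ω → ℕ}
    (hX : Measurable X) {C : NNReal} (h : ∫⁻ ω, (X ω : ENNReal) ^ 2 ∂μ ≤ C) :
    Integrable (fun ω => (X ω : ℝ) ^ 2) μ ∧ ∫ ω, (X ω : ℝ) ^ 2 ∂μ ≤ C := by
  have hm : Measurable fun ω => (X ω : ℝ) ^ 2 := (measurable_from_top.comp hX).pow_const 2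
  have he : ∀ ω, ENNReal.ofReal ((X ω : ℝ) ^ 2) = (X ω : ENNReal) ^ 2 := fun ω => by
    rw [ENNReal.ofReal_pow (Nat.cast_nonneg _), ENNReal.ofReal_natCast]
  constructor
  · refine ⟨hm.aestronglyMeasurable, ?_⟩
    rw [hasFiniteIntegral_iff_ofReal (Eventually.of_forall fun ω => sq_nonneg _)]
    simp only [he]
    exact h.trans_lt ENNReal.coe_lt_top
  · rw [integral_eq_lintegral_of_nonneg_ae (Eventually.of_forall fun ω => sq_nonneg _)
      hm.aestronglyMeasurable]
    simp only [he]
    exact ENNReal.toReal_le_coe_of_le_coe h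

/-- A factor known at present pulls a conditional upper bound through the expectation. -/
theorem integral_mul_le_of_condExp_le {Ω : Type*} {m mΩ : MeasurableSpace Ω} (hm : m ≤ mΩ)
    {μ : Measure Ω} [IsFiniteMeasure μ] {f g : Ω → ℝ} {b : ℝ} (hf : StronglyMeasurable[m] f)
    (hf0 : ∀ ω, 0 ≤ f ω) (hf2 : MemLp f 2 μ) (hg2 : MemLp g 2 μ)
    (h : μ[g | m] ≤ᵐ[μ] fun _ => b) :
    ∫ ω, f ω * g ω ∂μ ≤ b * ∫ ω, f ω ∂μ := by
  have hfg : Integrable (f * g) μ := hf2.integrable_mul hg2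
  have hpull := condExp_mul_of_stronglyMeasurable_left hf hfg (hg2.integrable one_le_two)
  calc ∫ ω, f ω * g ω ∂μ = ∫ ω, (μ[f * g | m]) ω ∂μ := (integral_condExp hm).symm
    _ ≤ ∫ ω, b * f ω ∂μ := by
        refine integral_mono_ae integrable_condExp ((hf2.integrable one_le_two).const_mul b) ?_
        filter_upwards [hpull, h] with ω h1 h2
        rw [h1, Pi.mul_apply, mul_comm b]
        exact mul_le_mul_of_nonneg_left h2 (hf0 ω)
    _ = b * ∫ ω, f ω ∂μ := integral_const_mul _ _

/-! ### Stability of the stochastic network -/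

namespace WirelessNetwork

theorem measurable_step {V S Ω : Type*} {N : WirelessNetwork V S} {m : MeasurableSpace Ω}
    {a : Ω → S → ℕ} {q M : Ω → N.Pair → ℕ}
    (ha : Measurable a) (hq : Measurable q) (hM : Measurable M) :
    Measurable fun ω => N.step (a ω) (q ω) (M ω) := by
  rw [measurable_pi_iff] at ha hq hM ⊢
  have htr : ∀ p, Measurable fun ω => N.transmitted (q ω) (M ω) p := fun p =>
    (hM p).min (hq p)
  intro p
  refine ((hq p).sub (htr p)).add ?_
  unfold inflow
  split_ifs
  exacts [ha _, htr _]

variable {V S : Type*} [Fintype S] {N : WirelessNetwork V S}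

/-- The drift of the quadratic Lyapunov function over `n` slots. -/
theorem IsBackPressurePath.lyapunov_window {a : ℕ → S → ℕ} {Q M : ℕ → N.Pair → ℕ}
    (h : N.IsBackPressurePath a Q M) {rate : S → ℝ} {c : ℝ} (hc : 0 ≤ c)
    (hpos : ∀ s, 0 ≤ rate s)
    (hdrain : ∀ q M, N.IsBackPressure q M →
      ∑ s, rate s * q (N.firstHop s) + c * ∑ p, (q p : ℝ) ≤
        ∑ p, (N.queueDiff q p : ℝ) * N.transmitted q M p)
    {n : ℕ} (hn : 0 < n) (t : ℕ) :
    N.lyapunov (fun p => (Q (t + n) p : ℝ)) + n * (c * ∑ p, (Q t p : ℝ)) ≤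
      N.lyapunov (fun p => (Q t p : ℝ)) +
        ∑ s, (Q t (N.firstHop s) : ℝ) *
          (∑ τ ∈ Finset.Ico t (t + n), (a τ s : ℝ) - n * rate s) +
        ((1 / 2) * Fintype.card N.Pair +
          n * (2 * Fintype.card N.Pair + ∑ s, rate s + c * Fintype.card N.Pair)) *
          (2 * (n ^ 2 + Fintype.card S * (n * ∑ s, ∑ τ ∈ Finset.Ico t (t + n), (a τ s : ℝ) ^ 2))) := by
  have hw := h.window_drift hc hpos hdrain (Nat.le_add_right t n)
  have hd := h.abs_sub_le (Nat.le_add_right t n)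
  rw [show ((t + n : ℕ) : ℝ) - t = n by push_cast; ring] at hw hd
  set K : ℝ := 2 * Fintype.card N.Pair + ∑ s, rate s + c * Fintype.card N.Pair with hK
  have hK0 : 0 ≤ K := by
    have := Finset.sum_nonneg fun s (_ : s ∈ Finset.univ) => hpos s
    positivity
  set W : ℝ := ∑ s, ∑ τ ∈ Finset.Ico t (t + n), (a τ s : ℝ) with hW
  have hW0 : 0 ≤ W :=
    Finset.sum_nonneg fun _ _ => Finset.sum_nonneg fun _ _ => Nat.cast_nonneg _
  have hn1 : (1 : ℝ) ≤ n := by exact_mod_cast hn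
  have hW2 : W ^ 2 ≤ Fintype.card S * (n * ∑ s, ∑ τ ∈ Finset.Ico t (t + n), (a τ s : ℝ) ^ 2) := by
    have hs : ∑ s, (∑ τ ∈ Finset.Ico t (t + n), (a τ s : ℝ)) ^ 2 ≤
        n * ∑ s, ∑ τ ∈ Finset.Ico t (t + n), (a τ s : ℝ) ^ 2 := by
      rw [Finset.mul_sum]
      refine Finset.sum_le_sum fun s _ => ?_
      simpa using
        sq_sum_le_card_mul_sum_sq (s := Finset.Ico t (t + n)) (f := fun τ => (a τ s : ℝ))
    calc W ^ 2 ≤ Fintype.card S * ∑ s, (∑ τ ∈ Finset.Ico t (t + n), (a τ s : ℝ)) ^ 2 :=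
          sq_sum_le_card_mul_sum_sq
      _ ≤ _ := by gcongr
  have h1 : N.lyapunov (fun p => (Q (t + n) p : ℝ)) - N.lyapunov (fun p => (Q t p : ℝ)) =
      ∑ p, (Q t p : ℝ) * ((Q (t + n) p : ℝ) - Q t p) +
        (1 / 2) * ∑ p, ((Q (t + n) p : ℝ) - Q t p) ^ 2 := by
    simp only [lyapunov, Finset.mul_sum, ← Finset.sum_sub_distrib, ← Finset.sum_add_distrib]
    exact Finset.sum_congr rfl fun p _ => by ring
  have h2 : ∑ p, ((Q (t + n) p : ℝ) - Q t p) ^ 2 ≤ ∑ _p : N.Pair, (n + W) ^ 2 :=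
    Finset.sum_le_sum fun p _ => sq_le_sq.2 ((hd p).trans (le_abs_self _))
  simp only [Finset.sum_const, Finset.card_univ, nsmul_eq_mul] at h2
  -- Because `n ≥ 1`, the linear window error is absorbed into the quadratic one. Cauchy–Schwarz
  -- then leaves only second moments of single-slot arrivals.
  have h3 : n + W ≤ (n + W) ^ 2 := by nlinarith
  have h4 := mul_le_mul_of_nonneg_left h3 (show 0 ≤ n * K by positivity)
  have h5 : (n + W) ^ 2 ≤
      2 * (n ^ 2 + Fintype.card S * (n * ∑ s, ∑ τ ∈ Finset.Ico t (t + n), (a τ s : ℝ) ^ 2)) := by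
    nlinarith [sq_nonneg (n - W)]
  have h6 := mul_le_mul_of_nonneg_left h5
    (show 0 ≤ (1 / 2) * (Fintype.card N.Pair : ℝ) + n * K by positivity)
  linarith

theorem sum_firstHop_le (N : WirelessNetwork V S) {f : N.Pair → ℝ} (hf : ∀ p, 0 ≤ f p) :
    ∑ s, f (N.firstHop s) ≤ ∑ p, f p := by
  rw [Fintype.sum_sigma]
  refine Finset.sum_le_sum fun s _ => ?_
  exact Finset.single_le_sum (f := fun k : Fin (N.hops s) => f ⟨s, k⟩)
    (fun _ _ => hf _) (Finset.mem_univ (⟨0, N.hops_pos s⟩ : Fin (N.hops s)))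

section Probability

variable {Ω : Type*} {mΩ : MeasurableSpace Ω} {μ : Measure Ω} {ℱ : Filtration ℕ mΩ}
  {A : ℕ → Ω → S → ℕ} {Q M : ℕ → Ω → N.Pair → ℕ} {q₀ : N.Pair → ℕ}

theorem measurable_queue (hA : ∀ t, Measurable[ℱ (t + 1)] (A t))
    (hM : ∀ t, Measurable[ℱ t] (M t)) (hQ0 : ∀ ω, Q 0 ω = q₀)
    (hpath : ∀ ω, N.IsBackPressurePath (fun t => A t ω) (fun t => Q t ω) (fun t => M t ω))
    (t : ℕ) : Measurable[ℱ t] (Q t) := by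
  induction t with
  | zero =>
    rw [show Q 0 = fun _ => q₀ from funext hQ0]
    exact measurable_const
  | succ t ih =>
    rw [show Q (t + 1) = fun ω => N.step (A t ω) (Q t ω) (M t ω) from
      funext fun ω => (hpath ω t).2]
    exact measurable_step (hA t) (ih.mono (ℱ.mono t.le_succ) le_rfl)
      ((hM t).mono (ℱ.mono t.le_succ) le_rfl)

/-- By any fixed time a queue is at most its initial value plus the elapsed time plus the arrivals
so far. The bound grows with `t` and serves only to make the expectations finite. -/
theorem memLp_queue [IsFiniteMeasure μ]
    (hA : ∀ t s, MemLp (fun ω => (A t ω s : ℝ)) 2 μ)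
    (hQ : ∀ t, Measurable (Q t)) (hQ0 : ∀ ω, Q 0 ω = q₀)
    (hpath : ∀ ω, N.IsBackPressurePath (fun t => A t ω) (fun t => Q t ω) (fun t => M t ω))
    (t : ℕ) (p : N.Pair) : MemLp (fun ω => (Q t ω p : ℝ)) 2 μ := by
  have hb : MemLp (fun ω => (q₀ p : ℝ) + t + ∑ s, ∑ τ ∈ Finset.Ico 0 t, (A τ ω s : ℝ)) 2 μ :=
    (memLp_const ((q₀ p : ℝ) + t)).add
      (memLp_finsetSum Finset.univ fun s _ => memLp_finsetSum (Finset.Ico 0 t) fun τ _ => hA τ s)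
  refine hb.mono (measurable_natCast_apply (hQ t) p).aestronglyMeasurable (Eventually.of_forall fun ω => ?_)
  have h := (abs_le.1 ((hpath ω).abs_sub_le (Nat.zero_le t) p)).2
  simp only [hQ0 ω, Nat.cast_zero, sub_zero] at h
  rw [Real.norm_of_nonneg (Nat.cast_nonneg _)]
  exact le_trans (by linarith) (le_abs_self _)

/-- Under back-pressure, with arrivals that keep rates at which the queues drain, the
time-averaged expected queue lengths stay bounded. -/
theorem stable_of_keepsRate [IsProbabilityMeasure μ] (hmeas : ∀ t, Measurable (A t))
    {rate : S → ℝ} {c : ℝ} (hc : 0 < c) (hpos : ∀ s, 0 ≤ rate s)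
    (hdrain : ∀ q M, N.IsBackPressure q M →
      ∑ s, rate s * q (N.firstHop s) + c * ∑ p, (q p : ℝ) ≤
        ∑ p, (N.queueDiff q p : ℝ) * N.transmitted q M p)
    (hkeep : KeepsRate μ ℱ A rate) (hM : ∀ t, Measurable[ℱ t] (M t)) (hQ0 : ∀ ω, Q 0 ω = q₀)
    (hpath : ∀ ω, N.IsBackPressurePath (fun t => A t ω) (fun t => Q t ω) (fun t => M t ω)) :
    N.Stable μ Q := by
  obtain ⟨hadapt, ⟨C, hC⟩, hcond⟩ := hkeep
  -- With `δ = c / 2`, the excess arrivals use up at most half of the drain `n * c`.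
  obtain ⟨n, hn, hcond⟩ := hcond (c / 2) (by positivity)
  have hn0 : (0 : ℝ) < n := by exact_mod_cast hn
  have hAsq := fun t s => integrable_natCast_sq (measurable_pi_iff.1 (hmeas t) s) (hC t s)
  have hA : ∀ t s, MemLp (fun ω => (A t ω s : ℝ)) 2 μ := fun t s =>
    (memLp_two_iff_integrable_sq
      (measurable_natCast_apply (hmeas t) s).aestronglyMeasurable).2
      (hAsq t s).1
  have hQF := measurable_queue hadapt hM hQ0 hpath
  have hQ : ∀ t p, MemLp (fun ω => (Q t ω p : ℝ)) 2 μ :=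
    memLp_queue hA (fun t => (hQF t).mono (ℱ.le t) le_rfl) hQ0 hpath
  have hQint : ∀ t p, Integrable (fun ω => (Q t ω p : ℝ)) μ := fun t p =>
    (hQ t p).integrable one_le_two
  have hQsum : ∀ t, Integrable (fun ω => ∑ p, (Q t ω p : ℝ)) μ := fun t =>
    integrable_finsetSum _ fun p _ => hQint t p
  have hG : ∀ t s, MemLp (fun ω => ∑ τ ∈ Finset.Ico t (t + n), (A τ ω s : ℝ)) 2 μ := fun t s =>
    memLp_finsetSum _ fun τ _ => hA τ s
  set v : ℕ → ℝ := fun t => ∫ ω, N.lyapunov (fun p => (Q t ω p : ℝ)) ∂μ with hv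
  set z : ℕ → ℝ := fun t => ∫ ω, ∑ p, (Q t ω p : ℝ) ∂μ with hz
  have hLint : ∀ t, Integrable (fun ω => N.lyapunov (fun p => (Q t ω p : ℝ))) μ := fun t =>
    (integrable_finsetSum _ fun p _ => (hQ t p).integrable_sq).const_mul _
  set D : ℝ := (1 / 2) * Fintype.card N.Pair +
    n * (2 * Fintype.card N.Pair + ∑ s, rate s + c * Fintype.card N.Pair) with hD
  have hD0 : 0 ≤ D := by
    have := Finset.sum_nonneg fun s (_ : s ∈ Finset.univ) => hpos s
    positivity
  set B : ℝ := D * (2 * (n ^ 2 + Fintype.card S * (n * (Fintype.card S * (n * C))))) with hB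
  have hv0 : ∀ t, 0 ≤ v t := fun t => integral_nonneg fun ω => by
    simp only [lyapunov]
    positivity
  have hz0 : ∀ t, 0 ≤ z t := fun t => integral_nonneg fun ω =>
    Finset.sum_nonneg fun _ _ => Nat.cast_nonneg _
  have hdrift : ∀ t, v (t + n) + n * (c / 2) * z t ≤ v t + B := by
    intro t
    have hsq : Integrable
        (fun ω => ∑ s, ∑ τ ∈ Finset.Ico t (t + n), (A τ ω s : ℝ) ^ 2) μ :=
      integrable_finsetSum _ fun s _ => integrable_finsetSum _ fun τ _ => (hAsq τ s).1
    have hcross : ∀ s, Integrable (fun ω => (Q t ω (N.firstHop s) : ℝ) *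
        (∑ τ ∈ Finset.Ico t (t + n), (A τ ω s : ℝ) - n * rate s)) μ := fun s =>
      (hQ t (N.firstHop s)).integrable_mul ((hG t s).sub (memLp_const (n * rate s)))
    have hrest : Integrable (fun ω => D * (2 * ((n : ℝ) ^ 2 + Fintype.card S *
        (n * ∑ s, ∑ τ ∈ Finset.Ico t (t + n), (A τ ω s : ℝ) ^ 2)))) μ :=
      (((integrable_const _).add ((hsq.const_mul _).const_mul _)).const_mul _).const_mul _
    have hcrosses : Integrable (fun ω => ∑ s, (Q t ω (N.firstHop s) : ℝ) *
        (∑ τ ∈ Finset.Ico t (t + n), (A τ ω s : ℝ) - n * rate s)) μ :=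
      integrable_finsetSum _ fun s _ => hcross s
    have hfirst : Integrable (fun ω => N.lyapunov (fun p => (Q t ω p : ℝ)) +
        ∑ s, (Q t ω (N.firstHop s) : ℝ) *
          (∑ τ ∈ Finset.Ico t (t + n), (A τ ω s : ℝ) - n * rate s)) μ := (hLint t).add hcrosses
    have hmono := integral_mono ((hLint (t + n)).add (((hQsum t).const_mul c).const_mul (n : ℝ)))
      (hfirst.add hrest)
      fun ω => (hpath ω).lyapunov_window hc.le hpos hdrain hn t
    simp only [Pi.add_apply] at hmono
    rw [integral_add (hLint (t + n)) (((hQsum t).const_mul c).const_mul (n : ℝ)),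
      integral_const_mul, integral_const_mul,
      integral_add hfirst hrest,
      integral_add (hLint t) hcrosses,
      integral_finsetSum _ fun s _ => hcross s, integral_const_mul, integral_const_mul,
      integral_add (integrable_const _) ((hsq.const_mul _).const_mul _), integral_const,
      integral_const_mul, integral_const_mul] at hmono
    have hY : ∫ ω, ∑ s, ∑ τ ∈ Finset.Ico t (t + n), (A τ ω s : ℝ) ^ 2 ∂μ ≤
        Fintype.card S * (n * C) := by
      rw [integral_finsetSum _ fun s _ => integrable_finsetSum _ fun τ _ => (hAsq τ s).1]
      refine (Finset.sum_le_sum fun s _ => ?_).trans_eq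
        (by rw [Finset.sum_const, Finset.card_univ, nsmul_eq_mul])
      rw [integral_finsetSum _ fun τ _ => (hAsq τ s).1]
      refine (Finset.sum_le_sum fun τ _ => (hAsq τ s).2).trans_eq ?_
      simp
    -- `Q t` is known at time `t`, so the conditional rate bound may be multiplied by it; first-hop
    -- queues are then bounded by all queues.
    have hX : ∑ s, ∫ ω, (Q t ω (N.firstHop s) : ℝ) *
        (∑ τ ∈ Finset.Ico t (t + n), (A τ ω s : ℝ) - n * rate s) ∂μ ≤ n * (c / 2) * z t := by
      have hs : ∀ s, ∫ ω, (Q t ω (N.firstHop s) : ℝ) *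
          (∑ τ ∈ Finset.Ico t (t + n), (A τ ω s : ℝ) - n * rate s) ∂μ ≤
          n * (c / 2) * ∫ ω, (Q t ω (N.firstHop s) : ℝ) ∂μ := by
        intro s
        have hf : StronglyMeasurable[ℱ t] fun ω => (Q t ω (N.firstHop s) : ℝ) :=
          (measurable_natCast_apply (hQF t) _).stronglyMeasurable
        have h1 := integral_mul_le_of_condExp_le (ℱ.le t) hf (fun ω => Nat.cast_nonneg _)
          (hQ t _) (hG t s) (hcond t s)
        have hprod : Integrable (fun ω => (Q t ω (N.firstHop s) : ℝ) *
            ∑ τ ∈ Finset.Ico t (t + n), (A τ ω s : ℝ)) μ := (hQ t _).integrable_mul (hG t s)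
        simp only [mul_sub]
        rw [integral_sub hprod ((hQint t _).mul_const _), integral_mul_const]
        linarith
      refine (Finset.sum_le_sum fun s _ => hs s).trans ?_
      rw [← Finset.mul_sum, hz]
      simp only
      rw [integral_finsetSum _ fun p _ => hQint t p]
      exact mul_le_mul_of_nonneg_left
        (N.sum_firstHop_le (f := fun p => ∫ ω, (Q t ω p : ℝ) ∂μ) fun p =>
          integral_nonneg fun ω => Nat.cast_nonneg _) (by positivity)
    have hBle : D * (2 * ((μ.real Set.univ) • (n : ℝ) ^ 2 + Fintype.card S *
        (n * ∫ ω, ∑ s, ∑ τ ∈ Finset.Ico t (t + n), (A τ ω s : ℝ) ^ 2 ∂μ))) ≤ B := by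
      rw [hB, probReal_univ, one_smul]
      gcongr
    linarith
  have hbound := sum_range_le_of_drift hv0 hdrift
  set κ : ℝ := n * (c / 2) with hκ
  have hκ0 : 0 < κ := by positivity
  -- For `T ≥ 1` the boundary terms `v i` are at most `T` times themselves, which makes the bound on
  -- the average independent of `T`.
  set E : ℝ := (∑ i ∈ Finset.range n, v i + B) / κ with hE
  have hE0 : 0 ≤ ∑ i ∈ Finset.range n, v i := Finset.sum_nonneg fun i _ => hv0 i
  have hlint : ∀ t, ∫⁻ ω, (N.totalQueue (Q t ω) : ENNReal) ∂μ = ENNReal.ofReal (z t) := by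
    intro t
    rw [hz, ofReal_integral_eq_lintegral_ofReal (hQsum t)
      (Eventually.of_forall fun ω => Finset.sum_nonneg fun _ _ => Nat.cast_nonneg _)]
    refine lintegral_congr fun ω => ?_
    rw [← Nat.cast_sum, ENNReal.ofReal_natCast]
    rfl
  unfold Stable
  refine lt_of_le_of_lt (limsup_le_of_le (h := ?_)) (ENNReal.ofReal_lt_top (r := E))
  filter_upwards [eventually_ge_atTop 1] with T hT
  have hT1 : (1 : ℝ) ≤ T := by exact_mod_cast hT
  refine ENNReal.div_le_of_le_mul ?_
  simp only [hlint]
  rw [← ENNReal.ofReal_sum_of_nonneg fun t _ => hz0 t, ← ENNReal.ofReal_natCast,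
    ← ENNReal.ofReal_mul' (by positivity)]
  refine ENNReal.ofReal_le_ofReal ?_
  rw [hE, div_mul_eq_mul_div, le_div_iff₀ hκ0, mul_comm]
  refine (hbound T).trans ?_
  nlinarith

end Probability

end WirelessNetwork

/-! ### Assembly of the fluid and network statements -/

theorem proposition2 {V : Type u} {S : Type v} [Fintype S] (N : WirelessNetwork V S)
    (rate : S → ℝ) (hrate : N.StrictlyInside rate) :
    ∃ T : ℝ, 0 < T ∧
      ∀ (Ω : Type w) [mΩ : MeasurableSpace Ω] (μ : Measure Ω) [IsProbabilityMeasure μ]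
        (A : ℕ → Ω → S → ℕ), (∀ t, Measurable (A t)) → SatisfiesSLLN μ A rate →
        -- the fluid model: the Lyapunov function has negative drift, and the queues drain by `T`
        (∀ᵐ ω ∂μ, ∀ q : ℝ → N.Pair → ℝ, N.IsFluidLimit (fun t => A t ω) q →
          (∀ᵐ t ∂(volume.restrict (Set.Ioi (0 : ℝ))), DifferentiableAt ℝ q t) ∧
          (∀ t : ℝ, 0 ≤ t → DifferentiableWithinAt ℝ q (Set.Ici t) t →
            0 < N.lyapunov (q t) →
            derivWithin (fun r => N.lyapunov (q r)) (Set.Ici t) t < 0) ∧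
          (∀ t : ℝ, T ≤ t → q t = 0)) ∧
        -- the network itself is stable
        (∀ (ℱ : Filtration ℕ mΩ) (Q M : ℕ → Ω → N.Pair → ℕ) (q₀ : N.Pair → ℕ),
          KeepsRate μ ℱ A rate →
          (∀ t, Measurable[ℱ t] (M t)) →
          (∀ ω, Q 0 ω = q₀) →
          (∀ ω, N.IsBackPressurePath (fun t => A t ω) (fun t => Q t ω) (fun t => M t ω)) →
          N.Stable μ Q) := by
  obtain ⟨c, hc, hdrain⟩ := hrate.exists_drain_rate
  refine ⟨2 / c, by positivity, fun Ω mΩ μ _ A hmeas hslln => ?_⟩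
  -- The rates are limits of nonnegative averages on an event of full, hence positive, probability.
  have hpos : ∀ s, 0 ≤ rate s := by
    obtain ⟨ω, hω⟩ := hslln.exists
    exact fun s => ge_of_tendsto' (hω s) fun t => by positivity
  have hdrain := hdrain hpos
  refine ⟨?_, fun ℱ Q M q₀ hkeep hM hQ0 hpath =>
    WirelessNetwork.stable_of_keepsRate hmeas hc hpos hdrain hkeep hM hQ0 hpath⟩
  filter_upwards [hslln] with ω hω q hq
  obtain ⟨hnonneg, hinit, hlip, hdrift⟩ := hq.bounds hc.le hpos hdrain hω
  have hL : 0 ≤ 1 + ∑ s, rate s := by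
    have := Finset.sum_nonneg fun s (_ : s ∈ Finset.univ) => hpos s
    positivity
  refine ⟨?_, fun t ht hdiff hV => ?_, fun t ht =>
    eq_zero_of_drift hc hL hnonneg hlip hdrift hinit.le ht⟩
  -- Rademacher's theorem for the Lipschitz limit, on an open half-line where one-set and full
  -- differentiability agree.
  · have := (lipschitzOnWith_of_abs_le hL hlip).mono Set.Ioi_subset_Ici_self
    filter_upwards [this.ae_differentiableWithinAt_real measurableSet_Ioi,
      ae_restrict_mem measurableSet_Ioi] with t h1 h2
    exact h1.differentiableAt (Ioi_mem_nhds h2)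
  · refine (derivWithin_sq_le_of_drift hlip hdrift ht hdiff).trans_lt ?_
    have hsum : 0 ≤ ∑ p, q t p := Finset.sum_nonneg fun p _ => hnonneg t ht p
    have hne : ∑ p, q t p ≠ 0 := fun h0 => by
      have h1 := Finset.sum_sq_le_sq_sum_of_nonneg (s := Finset.univ) (f := q t)
        fun p _ => hnonneg t ht p
      rw [h0] at h1
      unfold WirelessNetwork.lyapunov at hV
      linarith
    have := mul_pos hc (lt_of_le_of_ne hsum hne.symm)
    linarith
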